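/- Let $M$ be a smooth ($C^\infty$, finite-dimensional, Hausdorff, without boundary) manifold, with $\chi(M)$ its smooth vector fields and $\Omega^1(M)$ its smooth 1-forms. A bivector field $\Lambda$ is identified with the skew bundle map $\Lambda:T^*M\to TM$ given by $\langle\beta,\Lambda\alpha\rangle=\Lambda(\alpha,\beta)$. For a vector field $X$ put $[X,\Lambda]\alpha=[X,\Lambda\alpha]-\Lambda L_X\alpha$ (the Lie derivative $L_X\Lambda$), and let $[\Lambda,\Lambda]$ be the Schouten–Nijenhuis bracket, with the sign convention $\tfrac12[\Lambda,\Lambda](df,dg,dh)=\{\{f,g\},h\}+\{\{g,h\},f\}+\{\{h,f\},g\}$ where $\{f,g\}=\Lambda(df,dg)$. A pair $(\Lambda,E)$ of a smooth bivector field and a smooth vector field is a Jacobi structure if $[E,\Lambda]=0$ and $[\Lambda,\Lambda]=2E\wedge\Lambda$, where $(E\wedge\Lambda)(\alpha,\beta,\gamma)=\alpha(E)\Lambda(\beta,\gamma)+\beta(E)\Lambda(\gamma,\alpha)+\gamma(E)\Lambda(\alpha,\beta)$. For any bivector field $\Lambda$ and vector field $E$ define the anchor $\#_{(\Lambda,E)}(\alpha,f)=\Lambda\alpha+fE$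 and the bracket on $\Omega^1(M)\times C^\infty(M)$ $$\{(\alpha,f),(\beta,g)\}_{(\Lambda,E)}=\Big(L_{\Lambda\alpha}\beta-L_{\Lambda\beta}\alpha-d(\Lambda(\alpha,\beta))+fL_E\beta-gL_E\alpha-i_E(\alpha\wedge\beta),\ -\Lambda(\alpha,\beta)+\Lambda(\alpha,dg)-\Lambda(\beta,df)+fE(g)-gE(f)\Big).$$ Put also $\{\alpha,\beta\}_\Lambda=L_{\Lambda\alpha}\beta-L_{\Lambda\beta}\alpha-d(\Lambda(\alpha,\beta))$. For a smooth $(1,1)$-tensor field $J$ with transpose ${}^tJ$, let $N_J(X,Y)=[JX,JY]-J[JX,Y]-J[X,JY]+J^2[X,Y]$; if $J\circ\Lambda=\Lambda\circ{}^tJ$, then $J\Lambda:=J\circ\Lambda$ is a bivector field, and let $C(\Lambda,J)(\alpha,\beta)=\{\alpha,\beta\}_{J\Lambda}-\big(\{{}^tJ\alpha,\beta\}_\Lambda+\{\alpha,{}^tJ\beta\}_\Lambda-{}^tJ\{\alpha,\beta\}_\Lambda\big)$. **Proposition.** Let $(\Lambda,E)$ be a Jacobi structure on $M$ and $J$ a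 smooth $(1,1)$-tensor field such that $J\circ\Lambda=\Lambda\circ{}^tJ$ and $N_J(\Lambda\alpha+fE,\Lambda\beta+gE)=0$ for all $\alpha,\beta\in\Omega^1(M)$ and $f,g\in C^\infty(M)$. Then: 1. The condition (a) "$J([JE,\Lambda]\alpha+[E,J\Lambda]\alpha)=0$ for all $\alpha\in\Omega^1(M)$" holds if and only if $$[J\Lambda\alpha+fJE,\ gJE]=\#_{(J\Lambda,JE)}\big(\{(\alpha,f),(0,g)\}_{(J\Lambda,JE)}\big)\quad\text{for all }\alpha\in\Omega^1(M),\ f,g\in C^\infty(M).$$ 2. The condition (b) "$\big\langle{}^tJ\gamma,\ \Lambda\big(C(\Lambda,J)(\alpha,\beta)\big)-\Lambda(\alpha,\beta)JE+\Lambda(\alpha,{}^tJ\beta)E\big\rangle=0$ for all $\alpha,\beta,\gamma\in\Omega^1(M)$" holds if and only if $$[J\Lambda\alpha,\ J\Lambda\beta]=\#_{(J\Lambda,JE)}\big(\{(\alpha,0),(\beta,0)\}_{(J\Lambda,JE)}\big)\quad\text{for all }\alpha,\beta\in\Omega^1(M).$$ -/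

import Mathlib

open Set
open scoped Manifold ContDiff Bundle

noncomputable section

namespace JacobiNijenhuis

section Sections

variable {E : Type*} [NormedAddCommGroup E] [NormedSpace ℝ E]
  {H : Type*} [TopologicalSpace H] (I : ModelWithCorners ℝ E H)
  (M : Type*) [TopologicalSpace M] [ChartedSpace H M]

/-- Set-theoretic vector fields on `M`, i.e. sections of `TM` (no smoothness required). -/
abbrev VField : Type _ := (x : M) → TangentSpace I x

/-- Set-theoretic 1-forms on `M`, i.e. sections of `T*M` (no smoothness required). -/
abbrev Form : Type _ := (x : M) → (TangentSpace I x →L[ℝ] ℝ)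

/-- Set-theoretic (1,1)-tensor fields on `M`, i.e. fields of endomorphisms of `TM`. -/
abbrev EndField : Type _ := (x : M) → (TangentSpace I x →L[ℝ] TangentSpace I x)

/-- Set-theoretic bundle maps `T*M → TM` covering the identity. -/
abbrev SharpField : Type _ :=
  (x : M) → ((TangentSpace I x →L[ℝ] ℝ) →L[ℝ] TangentSpace I x)

variable [IsManifold I ∞ M]

/-- `χ(M)`: smooth vector fields. -/
abbrev SmoothVField : Type _ :=
  Cₛ^∞⟮I; E, fun x : M => TangentSpace I x⟯

/-- `Ω¹(M)`: smooth 1-forms. -/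
abbrev SmoothForm : Type _ :=
  Cₛ^∞⟮I; E →L[ℝ] ℝ, fun x : M => (TangentSpace I x →L[ℝ] ℝ)⟯

/-- Smooth (1,1)-tensor fields. -/
abbrev SmoothEndField : Type _ :=
  Cₛ^∞⟮I; E →L[ℝ] E, fun x : M => (TangentSpace I x →L[ℝ] TangentSpace I x)⟯

/-- Smooth bundle maps `T*M → TM`. -/
abbrev SmoothSharpField : Type _ :=
  Cₛ^∞⟮I; (E →L[ℝ] ℝ) →L[ℝ] E,
    fun x : M => ((TangentSpace I x →L[ℝ] ℝ) →L[ℝ] TangentSpace I x)⟯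

end Sections

section Operations

variable {E : Type*} [NormedAddCommGroup E] [NormedSpace ℝ E]
  {H : Type*} [TopologicalSpace H] {I : ModelWithCorners ℝ E H}
  {M : Type*} [TopologicalSpace M] [ChartedSpace H M]

/-! ### Cartan calculus -/

variable (I) in
/-- The differential `df` of a function. -/
def dFun (f : M → ℝ) : Form I M := fun x => mvfderiv I f x

/-- The derivative `X(f) = df(X)` of a function along a vector field. -/
def derivAlong (X : VField I M) (f : M → ℝ) : M → ℝ := fun x => dFun I f x (X x)

/-- The expression of the 1-form `α` in the chart at `x₀`, as a map `E → E*`. -/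
def formInChart (α : Form I M) (x₀ : M) (y : E) : E →L[ℝ] ℝ :=
  (α ((extChartAt I x₀).symm y)).comp
    (mfderivWithin 𝓘(ℝ, E) I (extChartAt I x₀).symm (range I) y)

/-- The exterior derivative `dα` of a 1-form, computed in the chart at `x`, so that
`i_v dα = (D_v α)(·) - (D_· α)(v)`; `dForm α x v` is the covector `i_v dα` at `x`. -/
def dForm (α : Form I M) (x : M) (v : TangentSpace I x) : TangentSpace I x →L[ℝ] ℝ :=
  let D : E →L[ℝ] E →L[ℝ] ℝ :=
    fderivWithin ℝ (formInChart α x) (range I) (extChartAt I x x)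
  let φ : TangentSpace I x →L[ℝ] E := mfderiv I 𝓘(ℝ, E) (extChartAt I x) x
  (D (φ v) - D.flip (φ v)).comp φ

/-- The Lie derivative of a 1-form along a vector field, `L_X α = d(i_X α) + i_X dα`. -/
def lieForm (X : VField I M) (α : Form I M) : Form I M :=
  fun x => dFun I (fun y => α y (X y)) x + dForm α x (X x)

/-- `i_X (α ∧ β) = α(X) β - β(X) α`. -/
def contractWedge (X : VField I M) (α β : Form I M) : Form I M :=
  fun x => α x (X x) • β x - β x (X x) • α x

/-! ### Bivector fields -/

/-- The vector field `Λα`. -/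
def sharp (Λ : SharpField I M) (α : Form I M) : VField I M := fun x => Λ x (α x)

/-- The function `Λ(α, β) = ⟨β, Λα⟩`. -/
def pair (Λ : SharpField I M) (α β : Form I M) : M → ℝ := fun x => β x (Λ x (α x))

/-- `Λ : T*M → TM` is a bivector field if `⟨α, Λβ⟩ + ⟨β, Λα⟩ = 0`. -/
def IsBivector (Λ : SharpField I M) : Prop :=
  ∀ (x : M) (a b : TangentSpace I x →L[ℝ] ℝ), a (Λ x b) + b (Λ x a) = 0

/-- The bracket `[X, Λ] = L_X Λ` of a vector field and a bivector field, as a map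
`α ↦ [X, Λ]α = [X, Λα] - Λ(L_X α)`. -/
def bracketOne (X : VField I M) (Λ : SharpField I M) (α : Form I M) : VField I M :=
  fun x => VectorField.mlieBracket I X (sharp Λ α) x - Λ x (lieForm X α x)

/-- The Schouten-Nijenhuis bracket `[P, Q]` of two bivector fields, as a triderivation of smooth
functions, i.e. `[P, Q](df, dg, dh)`.  In the sign convention used here, with
`{f, g}_P = P(df, dg)`, it is the sum over cyclic permutations of `(f, g, h)` of
`{{f, g}_Q, h}_P + {{f, g}_P, h}_Q`. -/
def schouten (P Q : SharpField I M) (f g h : M → ℝ) : M → ℝ :=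
  let t (f g h : M → ℝ) : M → ℝ :=
    pair P (dFun I (pair Q (dFun I f) (dFun I g))) (dFun I h)
      + pair Q (dFun I (pair P (dFun I f) (dFun I g))) (dFun I h)
  t f g h + t g h f + t h f g

/-- `(E ∧ Λ)(α, β, γ) = α(E) Λ(β, γ) + β(E) Λ(γ, α) + γ(E) Λ(α, β)`. -/
def wedge (X : VField I M) (Λ : SharpField I M) (α β γ : Form I M) : M → ℝ :=
  fun x => α x (X x) * pair Λ β γ x + β x (X x) * pair Λ γ α x + γ x (X x) * pair Λ α β x

/-! ### Action of a (1,1)-tensor field -/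

/-- The vector field `JX`. -/
def act (J : EndField I M) (X : VField I M) : VField I M := fun x => J x (X x)

/-- The 1-form `ᵗJα`. -/
def transp (J : EndField I M) (α : Form I M) : Form I M := fun x => (α x).comp (J x)

/-- The bundle map `J ∘ Λ : T*M → TM`. -/
def actSharp (J : EndField I M) (Λ : SharpField I M) : SharpField I M :=
  fun x => (J x).comp (Λ x)

/-- `J ∘ Λ = Λ ∘ ᵗJ`. -/
def Commutes (J : EndField I M) (Λ : SharpField I M) : Prop :=
  ∀ (x : M) (a : TangentSpace I x →L[ℝ] ℝ), J x (Λ x a) = Λ x (a.comp (J x))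

/-- If `J ∘ Λ = Λ ∘ ᵗJ` and `Λ` is a bivector field, then `JΛ` is a bivector field. -/
theorem IsBivector.actSharp {J : EndField I M} {Λ : SharpField I M}
    (hΛ : IsBivector Λ) (h : Commutes J Λ) : IsBivector (actSharp J Λ) := by
  intro x a b
  have h1 := hΛ x a (b.comp (J x))
  rw [← h x b] at h1
  exact h1

/-- The Nijenhuis torsion `N_J(X, Y) = [JX, JY] - J[JX, Y] - J[X, JY] + J²[X, Y]`. -/
def nijenhuis (J : EndField I M) (X Y : VField I M) : VField I M :=
  VectorField.mlieBracket I (act J X) (act J Y)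
    - act J (VectorField.mlieBracket I (act J X) Y)
    - act J (VectorField.mlieBracket I X (act J Y))
    + act J (act J (VectorField.mlieBracket I X Y))

/-- The bracket of 1-forms `{α, β}_Λ = L_{Λα} β - L_{Λβ} α - d(Λ(α, β))`. -/
def formBracket (Λ : SharpField I M) (α β : Form I M) : Form I M :=
  lieForm (sharp Λ α) β - lieForm (sharp Λ β) α - dFun I (pair Λ α β)

/-- `C(Λ, J)(α, β) = {α, β}_{JΛ} - ({ᵗJα, β}_Λ + {α, ᵗJβ}_Λ - ᵗJ{α, β}_Λ)`. -/
def concomitant (Λ : SharpField I M) (J : EndField I M) (α β : Form I M) : Form I M :=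
  formBracket (actSharp J Λ) α β
    - (formBracket Λ (transp J α) β + formBracket Λ α (transp J β)
      - transp J (formBracket Λ α β))

/-! ### The Lie algebroid of a pair `(Λ, E)` -/

/-- The anchor `#(α, f) = Λα + fE`. -/
def anchor (Λ : SharpField I M) (X : VField I M) (s : Form I M × (M → ℝ)) : VField I M :=
  fun x => Λ x (s.1 x) + s.2 x • X x

/-- The bracket `{(α, f), (β, g)}_{(Λ, E)}` on sections of `T*M ⊕ ℝ`, whose components are
`L_{Λα} β - L_{Λβ} α - d(Λ(α, β)) + f L_E β - g L_E α - i_E(α ∧ β)` and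
`-Λ(α, β) + Λ(α, dg) - Λ(β, df) + f E(g) - g E(f)`. -/
def pairBracket (Λ : SharpField I M) (X : VField I M) (s t : Form I M × (M → ℝ)) :
    Form I M × (M → ℝ) :=
  (fun x => lieForm (sharp Λ s.1) t.1 x - lieForm (sharp Λ t.1) s.1 x
      - dFun I (pair Λ s.1 t.1) x + s.2 x • lieForm X t.1 x - t.2 x • lieForm X s.1 x
      - contractWedge X s.1 t.1 x,
   fun x => - pair Λ s.1 t.1 x + pair Λ s.1 (dFun I t.2) x - pair Λ t.1 (dFun I s.2) x
      + s.2 x * derivAlong X t.2 x - t.2 x * derivAlong X s.2 x)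

end Operations

section Jacobi

variable {E : Type*} [NormedAddCommGroup E] [NormedSpace ℝ E]
  {H : Type*} [TopologicalSpace H] {I : ModelWithCorners ℝ E H}
  {M : Type*} [TopologicalSpace M] [ChartedSpace H M] [IsManifold I ∞ M]

/-- `(Λ, ξ)` is a Jacobi structure: `Λ` is a smooth bivector field and `ξ` a smooth vector field
with `[ξ, Λ] = 0` and `[Λ, Λ] = 2 ξ ∧ Λ`; the latter identity of trivector fields is tested on
differentials of smooth functions, which span every cotangent space. -/
structure IsJacobi (Λ : SmoothSharpField I M) (ξ : SmoothVField I M) : Prop where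
  isBivector : IsBivector (I := I) (M := M) Λ
  bracket_left : ∀ α : SmoothForm I M, bracketOne (I := I) (M := M) ξ Λ α = 0
  bracket_self : ∀ f g h : C^∞⟮I, M; ℝ⟯,
    schouten (I := I) (M := M) Λ Λ f g h
      = (2 : ℝ) • wedge (I := I) (M := M) ξ Λ (dFun I f) (dFun I g) (dFun I h)

/-- Condition (a): `J([JE, Λ]α + [E, JΛ]α) = 0` for all 1-forms `α`. -/
def ConditionA (Λ : SmoothSharpField I M) (ξ : SmoothVField I M) (J : SmoothEndField I M) :
    Prop :=
  ∀ α : SmoothForm I M,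
    act (I := I) (M := M) J (bracketOne (act (I := I) (M := M) J ξ) Λ α
      + bracketOne (I := I) (M := M) ξ (actSharp (I := I) (M := M) J Λ) α) = 0

/-- Condition (b): `⟨ᵗJγ, Λ(C(Λ, J)(α, β)) - Λ(α, β) JE + Λ(α, ᵗJβ) E⟩ = 0` for all 1-forms
`α, β, γ`. -/
def ConditionB (Λ : SmoothSharpField I M) (ξ : SmoothVField I M) (J : SmoothEndField I M) :
    Prop :=
  ∀ (α β γ : SmoothForm I M) (x : M),
    transp (I := I) (M := M) J γ x
      (Λ x (concomitant (I := I) (M := M) Λ J α β x)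
        - pair (I := I) (M := M) Λ α β x • J x (ξ x)
        + pair (I := I) (M := M) Λ α (transp (I := I) (M := M) J β) x • ξ x) = 0

end Jacobi

end JacobiNijenhuis

end

/-!
Cartan's formula gives `½[Λ, Λ](α, β, γ) = γ(Λ{α, β}_Λ - [Λα, Λβ])` when the left-hand side is the
cyclic sum of `(Λγ)(Λ(α, β)) - γ([Λα, Λβ])`. The right-hand side depends on `γ` only through its
value at the point, hence so does the cyclic sum on each of `α`, `β`, `γ`, and the identity
`[Λ, Λ] = 2 E ∧ Λ` passes from exact forms to all forms. Against `γ` it says that the anchor of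
`(Λ, E)` preserves the bracket of `(α, 0)` and `(β, 0)`. On `(α, f)` and `(0, g)` the failure of
any anchor to preserve brackets is `-g [E, Λ]α`.

Where the torsion of `J` vanishes, `J([JE, Λ]α + [E, JΛ]α) = [JE, JΛ]α`, while `J` applied to the
vector field of condition (b) is minus the failure of the anchor of `(JΛ, JE)` on `(α, 0)` and
`(β, 0)`. So each condition says that the corresponding failure for `(JΛ, JE)` is zero.
-/

noncomputable section

open Bundle Filter
open scoped Topology

namespace JacobiNijenhuis

section Charts

variable {E : Type*} [NormedAddCommGroup E] [NormedSpace ℝ E]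
  {H : Type*} [TopologicalSpace H] {I : ModelWithCorners ℝ E H}
  {M : Type*} [TopologicalSpace M] [ChartedSpace H M]

/-- The expression of the vector field `X` in the chart at `x`, as a map `E → E`; it is the
counterpart of `formInChart`. -/
def vFieldInChart (X : VField I M) (x : M) : E → E :=
  VectorField.mpullbackWithin 𝓘(ℝ, E) I (extChartAt I x).symm X (range I)

theorem formInChart_of_symm_eq (α : Form I M) (x : M) {z : E} {y : M}
    (hz : (extChartAt I x).symm z = y) :
    formInChart α x z =
      (α y).comp (mfderivWithin 𝓘(ℝ, E) I (extChartAt I x).symm (range I) z : E →L[ℝ] E) := by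
  subst hz
  rfl

variable [IsManifold I 1 M]

/-- Differentiability at `x` of a vector field, as a section of `TM`. -/
def VField.MDiffAt (X : VField I M) (x : M) : Prop :=
  MDifferentiableAt I (I.prod 𝓘(ℝ, E))
    (fun y => (⟨y, X y⟩ : TotalSpace E (TangentSpace I : M → Type _))) x

/-- Differentiability at `x` of a 1-form, as a section of `T*M`. -/
def Form.MDiffAt (α : Form I M) (x : M) : Prop :=
  MDifferentiableAt I (I.prod 𝓘(ℝ, E →L[ℝ] ℝ))
    (fun y => (⟨y, α y⟩ : TotalSpace (E →L[ℝ] ℝ) fun y : M => TangentSpace I y →L[ℝ] ℝ)) x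

theorem formInChart_self (α : Form I M) (x : M) :
    formInChart α x (extChartAt I x x) = α x := by
  rw [formInChart_of_symm_eq α x (extChartAt_to_inv x), mfderivWithin_range_extChartAt_symm]
  rfl

theorem vFieldInChart_self (X : VField I M) (x : M) :
    vFieldInChart X x (extChartAt I x x) = X x := by
  have transport (y : M) (hy : y = x) :
      ((mfderivWithin 𝓘(ℝ, E) I (extChartAt I x).symm (range I)
        (extChartAt I x x)).inverse (X y) : E) = X x := by
    subst hy
    exact mfderivWithin_extChartAt_symm_inverse_apply _
  exact transport _ (extChartAt_to_inv x)

theorem formInChart_apply_vFieldInChart (α : Form I M) (X : VField I M) {x : M}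
    {z : E} (hz : z ∈ (extChartAt I x).target) :
    formInChart α x z (vFieldInChart X x z) =
      α ((extChartAt I x).symm z) (X ((extChartAt I x).symm z)) :=
  congrArg (α ((extChartAt I x).symm z))
    ((isInvertible_mfderivWithin_extChartAt_symm (I := I) hz).self_apply_inverse _)

theorem formInChart_eq_inCoordinates (α : Form I M) {x : M} {z : E}
    (hz : z ∈ (extChartAt I x).target) :
    formInChart α x z =
      ContinuousLinearMap.inCoordinates E (TangentSpace I : M → Type _) ℝ (Trivial M ℝ)
        x ((extChartAt I x).symm z) x ((extChartAt I x).symm z)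
        (α ((extChartAt I x).symm z)) := by
  have hy : (extChartAt I x).symm z ∈ (chartAt H x).source := by
    simpa only [extChartAt_source] using (extChartAt I x).map_target hz
  have hsymm := TangentBundle.symmL_trivializationAt (I := I) hy
  rw [(extChartAt I x).right_inv hz] at hsymm
  ext v
  simp only [ContinuousLinearMap.inCoordinates, Trivial.fiberBundle_trivializationAt',
    Trivial.continuousLinearMapAt_trivialization, hsymm]
  rfl

theorem Form.MDiffAt.differentiableWithinAt_formInChart {α : Form I M} {x : M}
    (hα : α.MDiffAt x) :
    DifferentiableWithinAt ℝ (formInChart α x) (range I) (extChartAt I x x) := by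
  have coords := ((mdifferentiableAt_hom_bundle (F₁ := E) (E₁ := (TangentSpace I : M → Type _))
    (F₂ := ℝ) (E₂ := Trivial M ℝ) _).1 hα).2
  have chart := mdifferentiableWithinAt_extChartAt_symm (I := I) (mem_extChartAt_target x)
  refine (MDifferentiableAt.comp_mdifferentiableWithinAt_of_eq (extChartAt I x x) coords chart
    (extChartAt_to_inv x)).differentiableWithinAt.congr_of_eventuallyEq_of_mem ?_
    (mem_range_self _)
  filter_upwards [extChartAt_target_mem_nhdsWithin (I := I) x] with z hz
  exact formInChart_eq_inCoordinates α hz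

theorem Form.MDiffAt.apply {α : Form I M} {X : VField I M} {x : M}
    (hα : α.MDiffAt x) (hX : X.MDiffAt x) :
    MDifferentiableAt I 𝓘(ℝ, ℝ) (fun y => α y (X y)) x :=
  ((mdifferentiableAt_totalSpace _ _).1 <|
    MDifferentiableAt.clm_bundle_apply (F₁ := E) (E₁ := (TangentSpace I : M → Type _))
      (F₂ := ℝ) (E₂ := Trivial M ℝ) hα hX).2

omit [IsManifold I 1 M] in
theorem dFun_eq_fderivWithin {f : M → ℝ} {x : M} (hf : MDifferentiableAt I 𝓘(ℝ, ℝ) f x) :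
    dFun I f x = fderivWithin ℝ (f ∘ (extChartAt I x).symm) (range I) (extChartAt I x x) :=
  hf.mfderiv

theorem dForm_apply (α : Form I M) (x : M) (v w : TangentSpace I x) :
    dForm α x v w = fderivWithin ℝ (formInChart α x) (range I) (extChartAt I x x) v w
      - fderivWithin ℝ (formInChart α x) (range I) (extChartAt I x x) w v := by
  simp only [dForm, mfderiv_extChartAt_self]
  rfl

theorem formInChart_dFun {f : M → ℝ} {x : M} {z : E} (hz : z ∈ (extChartAt I x).target)
    (hf : MDifferentiableAt I 𝓘(ℝ, ℝ) f ((extChartAt I x).symm z)) :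
    formInChart (dFun I f) x z =
      fderivWithin ℝ (f ∘ (extChartAt I x).symm) (range I) z := by
  have chart := mdifferentiableWithinAt_extChartAt_symm (I := I) hz
  have uniq : UniqueMDiffWithinAt 𝓘(ℝ, E) (range I) z :=
    (I.uniqueDiffOn z (extChartAt_target_subset_range x hz)).uniqueMDiffWithinAt
  exact (mfderiv_comp_mfderivWithin z hf chart uniq).symm.trans mfderivWithin_eq_fderivWithin

end Charts

section Cartan

variable {E : Type*} [NormedAddCommGroup E] [NormedSpace ℝ E]
  {H : Type*} [TopologicalSpace H] {I : ModelWithCorners ℝ E H}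
  {M : Type*} [TopologicalSpace M] [ChartedSpace H M]

theorem contDiffWithinAt_comp_extChartAt_symm {n : WithTop ℕ∞} {f : M → ℝ} {x : M}
    (hf : ContMDiffAt I 𝓘(ℝ, ℝ) n f x) :
    ContDiffWithinAt ℝ n (f ∘ (extChartAt I x).symm) (range I) (extChartAt I x x) :=
  (contMDiffAt_iff.1 hf).2

theorem formInChart_dFun_eventuallyEq [IsManifold I 1 M] {f : M → ℝ}
    (hf : MDifferentiable I 𝓘(ℝ, ℝ) f) (x : M) :
    formInChart (dFun I f) x =ᶠ[𝓝[range I] extChartAt I x x]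
      fderivWithin ℝ (f ∘ (extChartAt I x).symm) (range I) := by
  filter_upwards [extChartAt_target_mem_nhdsWithin (I := I) x] with z hz
  exact formInChart_dFun hz (hf _)

theorem dForm_dFun [IsManifold I 1 M] {f : M → ℝ} (hf : ContMDiff I 𝓘(ℝ, ℝ) 2 f) (x : M)
    (v : TangentSpace I x) : dForm (dFun I f) x v = 0 := by
  have local_expr := formInChart_dFun_eventuallyEq (hf.mdifferentiable (by simp)) x
  have symm := (contDiffWithinAt_comp_extChartAt_symm (hf x)).isSymmSndFDerivWithinAt (by simp)
    I.uniqueDiffOn (I.range_subset_closure_interior (mem_range_self _)) (mem_range_self _)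
  ext w
  rw [dForm_apply, local_expr.fderivWithin_eq_of_mem (mem_range_self _)]
  exact sub_eq_zero.2 (symm.eq v w)

theorem contMDiff_dFun [IsManifold I ∞ M] {f : M → ℝ} (hf : ContMDiff I 𝓘(ℝ, ℝ) ∞ f) :
    ContMDiff I (I.prod 𝓘(ℝ, E →L[ℝ] ℝ)) ∞ (fun y => (⟨y, dFun I f y⟩ :
      TotalSpace (E →L[ℝ] ℝ) fun y : M => TangentSpace I y →L[ℝ] ℝ)) := by
  intro x
  refine (contMDiffAt_hom_bundle (F₁ := E) (E₁ := (TangentSpace I : M → Type _))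
    (F₂ := ℝ) (E₂ := Trivial M ℝ) _).2 ⟨contMDiffAt_id, ?_⟩
  have deriv_smooth : ContDiffWithinAt ℝ ∞
      (fderivWithin ℝ (f ∘ (extChartAt I x).symm) (range I)) (range I) (extChartAt I x x) :=
    (contDiffWithinAt_comp_extChartAt_symm (hf x)).fderivWithin_right I.uniqueDiffOn (by simp)
      (mem_range_self _)
  have smooth_in_chart : ContMDiffAt I 𝓘(ℝ, E →L[ℝ] ℝ) ∞
      (fderivWithin ℝ (f ∘ (extChartAt I x).symm) (range I) ∘ extChartAt I x) x :=
    deriv_smooth.contMDiffWithinAt.comp x contMDiffAt_extChartAt fun y _ => mem_range_self _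
  refine smooth_in_chart.congr_of_eventuallyEq ?_
  filter_upwards [extChartAt_source_mem_nhds (I := I) x] with y hy
  have hz := (extChartAt I x).map_source hy
  have local_expr := (formInChart_eq_inCoordinates (dFun I f) hz).symm.trans
    (formInChart_dFun hz (hf.mdifferentiable (by simp) _))
  rwa [(extChartAt I x).left_inv hy] at local_expr

theorem lieForm_dFun [IsManifold I 1 M] {f : M → ℝ} (hf : ContMDiff I 𝓘(ℝ, ℝ) 2 f)
    (X : VField I M) : lieForm X (dFun I f) = dFun I (derivAlong X f) := by
  ext1 x
  rw [lieForm, dForm_dFun hf, add_zero]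
  rfl

section Bracket

variable [CompleteSpace E] [IsManifold I 2 M]

theorem VField.MDiffAt.differentiableWithinAt_vFieldInChart {X : VField I M} {x : M}
    (hX : X.MDiffAt x) :
    DifferentiableWithinAt ℝ (vFieldInChart X x) (range I) (extChartAt I x x) := by
  simpa only [vFieldInChart, preimage_univ, univ_inter] using
    MDifferentiableWithinAt.differentiableWithinAt_mpullbackWithin_vectorField
      (mdifferentiableWithinAt_univ.2 hX)

omit [CompleteSpace E] in
theorem mlieBracket_eq_fderivWithin_sub (X Y : VField I M) (x : M) :
    VectorField.mlieBracket I X Y x =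
      (fderivWithin ℝ (vFieldInChart Y x) (range I) (extChartAt I x x) (X x) -
        fderivWithin ℝ (vFieldInChart X x) (range I) (extChartAt I x x) (Y x) : E) := by
  have bracket_in_chart (A : E →L[ℝ] E) (hA : A = ContinuousLinearMap.id ℝ E) (s : Set E)
      (hs : s = range I) :
      A.inverse (VectorField.lieBracketWithin ℝ (vFieldInChart X x) (vFieldInChart Y x) s
          (extChartAt I x x)) =
        fderivWithin ℝ (vFieldInChart Y x) (range I) (extChartAt I x x)
            (vFieldInChart X x (extChartAt I x x)) -
          fderivWithin ℝ (vFieldInChart X x) (range I) (extChartAt I x x)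
            (vFieldInChart Y x (extChartAt I x x)) := by
    rw [hA, hs, ContinuousLinearMap.inverse_id]
    rfl
  rw [← VectorField.mlieBracketWithin_univ, VectorField.mlieBracketWithin_apply]
  rw [vFieldInChart_self, vFieldInChart_self] at bracket_in_chart
  exact bracket_in_chart _ mfderiv_extChartAt_self _ (by rw [preimage_univ, univ_inter])

theorem dFun_apply_vField {α : Form I M} {X : VField I M} {x : M} (hα : α.MDiffAt x)
    (hX : X.MDiffAt x) (v : TangentSpace I x) :
    dFun I (fun y => α y (X y)) x v =
      α x (fderivWithin ℝ (vFieldInChart X x) (range I) (extChartAt I x x) v) +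
        fderivWithin ℝ (formInChart α x) (range I) (extChartAt I x x) v (X x) := by
  have local_expr : (fun y => α y (X y)) ∘ (extChartAt I x).symm
      =ᶠ[𝓝[range I] extChartAt I x x] fun z => formInChart α x z (vFieldInChart X x z) := by
    filter_upwards [extChartAt_target_mem_nhdsWithin (I := I) x] with z hz
    exact (formInChart_apply_vFieldInChart α X hz).symm
  have uniq : UniqueDiffWithinAt ℝ (range I) (extChartAt I x x) :=
    I.uniqueDiffOn _ (mem_range_self _)
  have leibniz := fderivWithin_clm_apply uniq hα.differentiableWithinAt_formInChart
    hX.differentiableWithinAt_vFieldInChart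
  rw [← local_expr.fderivWithin_eq_of_mem (mem_range_self _), formInChart_self,
    vFieldInChart_self] at leibniz
  rw [dFun_eq_fderivWithin (hα.apply hX)]
  exact DFunLike.congr_fun leibniz v

theorem lieForm_apply {X Y : VField I M} {α : Form I M} {x : M} (hX : X.MDiffAt x)
    (hY : Y.MDiffAt x) (hα : α.MDiffAt x) :
    lieForm X α x (Y x) = dFun I (fun y => α y (Y y)) x (X x)
      - α x (VectorField.mlieBracket I X Y x) := by
  have leibniz (a : E →L[ℝ] ℝ) (p q : E) (r s : ℝ) :
      a p + r + (s - r) = a q + s - a (q - p) := by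
    rw [map_sub]; ring
  rw [lieForm, add_apply, dForm_apply, dFun_apply_vField hα hX, dFun_apply_vField hα hY,
    mlieBracket_eq_fderivWithin_sub]
  exact leibniz _ _ _ _ _

end Bracket

end Cartan

section TensorFields

variable {E : Type*} [NormedAddCommGroup E] [NormedSpace ℝ E]
  {H : Type*} [TopologicalSpace H] {I : ModelWithCorners ℝ E H}
  {M : Type*} [TopologicalSpace M] [ChartedSpace H M]

section Differentiability

variable [IsManifold I 1 M]

/-- Differentiability at `x` of a bundle map `T*M → TM`, as a section of `Hom(T*M, TM)`. -/
def SharpField.MDiffAt (Λ : SharpField I M) (x : M) : Prop :=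
  MDifferentiableAt I (I.prod 𝓘(ℝ, (E →L[ℝ] ℝ) →L[ℝ] E))
    (fun y => (⟨y, Λ y⟩ : TotalSpace ((E →L[ℝ] ℝ) →L[ℝ] E)
      fun y : M => (TangentSpace I y →L[ℝ] ℝ) →L[ℝ] TangentSpace I y)) x

/-- Differentiability at `x` of a (1,1)-tensor field, as a section of `End(TM)`. -/
def EndField.MDiffAt (J : EndField I M) (x : M) : Prop :=
  MDifferentiableAt I (I.prod 𝓘(ℝ, E →L[ℝ] E))
    (fun y => (⟨y, J y⟩ : TotalSpace (E →L[ℝ] E)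
      fun y : M => TangentSpace I y →L[ℝ] TangentSpace I y)) x

theorem Form.MDiffAt.sharp {Λ : SharpField I M} {α : Form I M} {x : M} (hα : α.MDiffAt x)
    (hΛ : Λ.MDiffAt x) : (sharp Λ α).MDiffAt x :=
  MDifferentiableAt.clm_bundle_apply (F₁ := E →L[ℝ] ℝ)
    (E₁ := fun y : M => TangentSpace I y →L[ℝ] ℝ) (F₂ := E)
    (E₂ := (TangentSpace I : M → Type _)) hΛ hα

theorem VField.MDiffAt.act {J : EndField I M} {X : VField I M} {x : M} (hX : X.MDiffAt x)
    (hJ : J.MDiffAt x) : (act J X).MDiffAt x :=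
  MDifferentiableAt.clm_bundle_apply (F₁ := E) (E₁ := (TangentSpace I : M → Type _)) (F₂ := E)
    (E₂ := (TangentSpace I : M → Type _)) hJ hX

theorem inCoordinates_comp {x y : M} (hy : y ∈ (chartAt H x).source)
    (a : TangentSpace I y →L[ℝ] ℝ) (A : TangentSpace I y →L[ℝ] TangentSpace I y) :
    ContinuousLinearMap.inCoordinates E (TangentSpace I : M → Type _) ℝ (Trivial M ℝ)
        x y x y (a.comp A) =
      (ContinuousLinearMap.inCoordinates E (TangentSpace I : M → Type _) ℝ (Trivial M ℝ)
        x y x y a).comp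
      (ContinuousLinearMap.inCoordinates E (TangentSpace I : M → Type _) E
        (TangentSpace I : M → Type _) x y x y A) := by
  have hy' : y ∈ (trivializationAt E (TangentSpace I : M → Type _) x).baseSet := hy
  ext v
  simp only [ContinuousLinearMap.inCoordinates, ContinuousLinearMap.comp_apply,
    Trivialization.symmL_continuousLinearMapAt _ hy']

theorem Form.MDiffAt.transp {J : EndField I M} {α : Form I M} {x : M} (hα : α.MDiffAt x)
    (hJ : J.MDiffAt x) : (transp J α).MDiffAt x := by
  have form_coords := ((mdifferentiableAt_hom_bundle (F₁ := E)
    (E₁ := (TangentSpace I : M → Type _)) (F₂ := ℝ) (E₂ := Trivial M ℝ) _).1 hα).2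
  have end_coords := ((mdifferentiableAt_hom_bundle (F₁ := E)
    (E₁ := (TangentSpace I : M → Type _)) (F₂ := E) (E₂ := (TangentSpace I : M → Type _)) _).1 hJ).2
  refine (mdifferentiableAt_hom_bundle (F₁ := E) (E₁ := (TangentSpace I : M → Type _))
    (F₂ := ℝ) (E₂ := Trivial M ℝ) _).2 ⟨mdifferentiableAt_id, ?_⟩
  refine (form_coords.clm_comp end_coords).congr_of_eventuallyEq ?_
  filter_upwards [chart_source_mem_nhds H x] with y hy
  exact inCoordinates_comp hy (α y) (J y)

end Differentiability

section Smooth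

variable [IsManifold I ∞ M]

theorem SmoothVField.mdiffAt (X : SmoothVField I M) (x : M) :
    VField.MDiffAt (I := I) (M := M) X x :=
  (X.contMDiff x).mdifferentiableAt (by simp)

theorem SmoothForm.mdiffAt (α : SmoothForm I M) (x : M) : Form.MDiffAt (I := I) (M := M) α x :=
  (α.contMDiff x).mdifferentiableAt (by simp)

theorem SmoothSharpField.mdiffAt (Λ : SmoothSharpField I M) (x : M) :
    SharpField.MDiffAt (I := I) (M := M) Λ x :=
  (Λ.contMDiff x).mdifferentiableAt (by simp)

theorem SmoothEndField.mdiffAt (J : SmoothEndField I M) (x : M) :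
    EndField.MDiffAt (I := I) (M := M) J x :=
  (J.contMDiff x).mdifferentiableAt (by simp)

theorem Form.MDiffAt.dFun {f : M → ℝ} (hf : ContMDiff I 𝓘(ℝ, ℝ) ∞ f) (x : M) :
    (dFun I f).MDiffAt x :=
  (contMDiff_dFun hf x).mdifferentiableAt (by simp)

theorem exists_dFun_eq [FiniteDimensional ℝ E] [T2Space M] (x : M)
    (a : TangentSpace I x →L[ℝ] ℝ) : ∃ f : C^∞⟮I, M; ℝ⟯, dFun I f x = a := by
  let bump : SmoothBumpFunction I x := Classical.arbitrary _
  let a' : E →L[ℝ] ℝ := a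
  have smooth : ContMDiff I 𝓘(ℝ, ℝ) ∞ fun y => bump y • a' (extChartAt I x y) :=
    bump.contMDiff_smul (a'.contMDiff.comp_contMDiffOn contMDiffOn_extChartAt)
  have linear_in_chart : (fun y => bump y • a' (extChartAt I x y)) ∘ (extChartAt I x).symm
      =ᶠ[𝓝[range I] extChartAt I x x] a' := by
    have near_x : Tendsto (extChartAt I x).symm (𝓝[range I] extChartAt I x x) (𝓝 x) := by
      simpa only [extChartAt_to_inv] using
        (continuousAt_extChartAt_symm (I := I) x).continuousWithinAt.tendsto
    filter_upwards [extChartAt_target_mem_nhdsWithin (I := I) x,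
      near_x.eventually bump.eventuallyEq_one] with z hz hbump
    simp only [Function.comp_apply, hbump, Pi.one_apply, one_smul, (extChartAt I x).right_inv hz]
  refine ⟨⟨_, smooth⟩, (dFun_eq_fderivWithin (smooth.mdifferentiable (by simp) x)).trans ?_⟩
  rw [linear_in_chart.fderivWithin_eq_of_mem (mem_range_self _)]
  exact a'.fderivWithin (I.uniqueDiffOn _ (mem_range_self _))

theorem exists_smoothForm_eq [FiniteDimensional ℝ E] [T2Space M] (x : M)
    (a : TangentSpace I x →L[ℝ] ℝ) : ∃ γ : SmoothForm I M, γ x = a := by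
  obtain ⟨f, hf⟩ := exists_dFun_eq x a
  exact ⟨⟨dFun I f, contMDiff_dFun f.contMDiff⟩, hf⟩

end Smooth

theorem eq_zero_of_forall_covector {x : M} {v : TangentSpace I x}
    (h : ∀ a : TangentSpace I x →L[ℝ] ℝ, a v = 0) : v = 0 :=
  SeparatingDual.eq_zero_of_forall_dual_eq_zero (R := ℝ) (V := E) h

end TensorFields

section Schouten

variable {E : Type*} [NormedAddCommGroup E] [NormedSpace ℝ E]
  {H : Type*} [TopologicalSpace H] {I : ModelWithCorners ℝ E H}
  {M : Type*} [TopologicalSpace M] [ChartedSpace H M] {Λ : SharpField I M}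

theorem dFun_neg (f : M → ℝ) : dFun I (-f) = -dFun I f := by
  ext1 x
  exact mvfderiv_neg

theorem IsBivector.apply_swap (hΛ : IsBivector Λ) {x : M} (a b : TangentSpace I x →L[ℝ] ℝ) :
    a (Λ x b) = -b (Λ x a) :=
  eq_neg_of_add_eq_zero_left (hΛ x a b)

theorem IsBivector.pair_swap (hΛ : IsBivector Λ) (α β : Form I M) :
    pair Λ β α = -pair Λ α β := by
  ext x
  exact hΛ.apply_swap (α x) (β x)

theorem IsBivector.dFun_pair_swap_apply (hΛ : IsBivector Λ) (α β : Form I M) {x : M}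
    (v : TangentSpace I x) : dFun I (pair Λ β α) x v = -dFun I (pair Λ α β) x v := by
  rw [hΛ.pair_swap α β, dFun_neg]
  rfl

/-- The value `½[Λ, Λ](α, β, γ)` of the Schouten-Nijenhuis bracket on arbitrary 1-forms, as the
cyclic sum of `(Λγ)(Λ(α, β)) - γ([Λα, Λβ])`; `schouten` only evaluates it on exact forms. -/
def halfSchouten (Λ : SharpField I M) (α β γ : Form I M) : M → ℝ :=
  let t (α β γ : Form I M) : M → ℝ := fun x =>
    dFun I (pair Λ α β) x (Λ x (γ x))
      - γ x (VectorField.mlieBracket I (sharp Λ α) (sharp Λ β) x)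
  t α β γ + t β γ α + t γ α β

theorem halfSchouten_rotate (Λ : SharpField I M) (α β γ : Form I M) :
    halfSchouten Λ β γ α = halfSchouten Λ α β γ := by
  simp only [halfSchouten]
  abel

section Tensoriality

variable [CompleteSpace E] [IsManifold I 2 M] {α β γ α' β' γ' : Form I M} {x : M}

theorem halfSchouten_eq_formBracket (hΛ : IsBivector Λ) (hΛx : Λ.MDiffAt x) (hα : α.MDiffAt x)
    (hβ : β.MDiffAt x) (hγ : γ.MDiffAt x) :
    halfSchouten Λ α β γ x = γ x (Λ x (formBracket Λ α β x))
      - γ x (VectorField.mlieBracket I (sharp Λ α) (sharp Λ β) x) := by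
  have lie_β : lieForm (sharp Λ α) β x (Λ x (γ x)) = dFun I (pair Λ γ β) x (Λ x (α x))
      - β x (VectorField.mlieBracket I (sharp Λ α) (sharp Λ γ) x) :=
    lieForm_apply (hα.sharp hΛx) (hγ.sharp hΛx) hβ
  have lie_α : lieForm (sharp Λ β) α x (Λ x (γ x)) = dFun I (pair Λ γ α) x (Λ x (β x))
      - α x (VectorField.mlieBracket I (sharp Λ β) (sharp Λ γ) x) :=
    lieForm_apply (hβ.sharp hΛx) (hγ.sharp hΛx) hα
  rw [hΛ.apply_swap]
  simp only [halfSchouten, formBracket, Pi.add_apply, Pi.sub_apply, sub_apply, lie_α, lie_β,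
    hΛ.dFun_pair_swap_apply β γ,
    VectorField.mlieBracket_swap_apply (V := sharp Λ γ) (W := sharp Λ α), map_neg]
  ring

theorem halfSchouten_congr_right (hΛ : IsBivector Λ) (hΛx : Λ.MDiffAt x) (hα : α.MDiffAt x)
    (hβ : β.MDiffAt x) (hγ : γ.MDiffAt x) (hγ' : γ'.MDiffAt x) (h : γ x = γ' x) :
    halfSchouten Λ α β γ x = halfSchouten Λ α β γ' x := by
  rw [halfSchouten_eq_formBracket hΛ hΛx hα hβ hγ, halfSchouten_eq_formBracket hΛ hΛx hα hβ hγ', h]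

theorem halfSchouten_congr (hΛ : IsBivector Λ) (hΛx : Λ.MDiffAt x) (hα : α.MDiffAt x)
    (hβ : β.MDiffAt x) (hγ : γ.MDiffAt x) (hα' : α'.MDiffAt x) (hβ' : β'.MDiffAt x)
    (hγ' : γ'.MDiffAt x) (h₁ : α x = α' x) (h₂ : β x = β' x) (h₃ : γ x = γ' x) :
    halfSchouten Λ α β γ x = halfSchouten Λ α' β' γ' x := calc
  halfSchouten Λ α β γ x = halfSchouten Λ α β γ' x :=
    halfSchouten_congr_right hΛ hΛx hα hβ hγ hγ' h₃
  _ = halfSchouten Λ γ' α β x := by rw [halfSchouten_rotate]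
  _ = halfSchouten Λ γ' α β' x := halfSchouten_congr_right hΛ hΛx hγ' hα hβ hβ' h₂
  _ = halfSchouten Λ β' γ' α x := by rw [halfSchouten_rotate]
  _ = halfSchouten Λ β' γ' α' x := halfSchouten_congr_right hΛ hΛx hβ' hγ' hα hα' h₁
  _ = halfSchouten Λ α' β' γ' x := by rw [halfSchouten_rotate]

end Tensoriality

theorem dFun_mlieBracket_sharp_dFun [CompleteSpace E] [IsManifold I ∞ M] {x : M}
    (hΛ : IsBivector Λ) (hΛx : Λ.MDiffAt x) {f g h : M → ℝ} (hf : ContMDiff I 𝓘(ℝ, ℝ) ∞ f)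
    (hg : ContMDiff I 𝓘(ℝ, ℝ) ∞ g) (hh : ContMDiff I 𝓘(ℝ, ℝ) ∞ h) :
    dFun I h x (VectorField.mlieBracket I (sharp Λ (dFun I f)) (sharp Λ (dFun I g)) x) =
      dFun I (pair Λ (dFun I g) (dFun I h)) x (Λ x (dFun I f x))
        + dFun I (pair Λ (dFun I h) (dFun I f)) x (Λ x (dFun I g x)) := by
  have cartan : dFun I (pair Λ (dFun I f) (dFun I h)) x (Λ x (dFun I g x)) =
      dFun I (pair Λ (dFun I g) (dFun I h)) x (Λ x (dFun I f x)) - dFun I h x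
        (VectorField.mlieBracket I (sharp Λ (dFun I f)) (sharp Λ (dFun I g)) x) := by
    refine Eq.trans ?_ (lieForm_apply ((Form.MDiffAt.dFun hf x).sharp hΛx)
      ((Form.MDiffAt.dFun hg x).sharp hΛx) (Form.MDiffAt.dFun hh x))
    rw [lieForm_dFun (hh.of_le (by norm_cast))]
    rfl
  rw [hΛ.dFun_pair_swap_apply] at cartan
  linarith

theorem schouten_self_eq_two_mul_halfSchouten [CompleteSpace E] [IsManifold I ∞ M] {x : M}
    (hΛ : IsBivector Λ) (hΛx : Λ.MDiffAt x) {f g h : M → ℝ} (hf : ContMDiff I 𝓘(ℝ, ℝ) ∞ f)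
    (hg : ContMDiff I 𝓘(ℝ, ℝ) ∞ g) (hh : ContMDiff I 𝓘(ℝ, ℝ) ∞ h) :
    schouten Λ Λ f g h x = 2 * halfSchouten Λ (dFun I f) (dFun I g) (dFun I h) x := by
  have swap (F k : M → ℝ) :
      pair Λ (dFun I F) (dFun I k) x = -dFun I F x (Λ x (dFun I k x)) := hΛ.apply_swap _ _
  simp only [schouten, halfSchouten, Pi.add_apply, swap,
    dFun_mlieBracket_sharp_dFun hΛ hΛx hf hg hh, dFun_mlieBracket_sharp_dFun hΛ hΛx hg hh hf,
    dFun_mlieBracket_sharp_dFun hΛ hΛx hh hf hg]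
  ring

theorem IsJacobi.halfSchouten_eq_wedge [FiniteDimensional ℝ E] [T2Space M] [IsManifold I ∞ M]
    {Λ : SmoothSharpField I M} {ξ : SmoothVField I M} (hΛ : IsJacobi Λ ξ) {α β γ : Form I M}
    {x : M} (hα : α.MDiffAt x) (hβ : β.MDiffAt x) (hγ : γ.MDiffAt x) :
    halfSchouten (I := I) (M := M) Λ α β γ x = wedge (I := I) (M := M) ξ Λ α β γ x := by
  have : CompleteSpace E := FiniteDimensional.complete ℝ E
  obtain ⟨f, hf⟩ := exists_dFun_eq x (α x)
  obtain ⟨g, hg⟩ := exists_dFun_eq x (β x)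
  obtain ⟨h, hh⟩ := exists_dFun_eq x (γ x)
  have hΛx := SmoothSharpField.mdiffAt Λ x
  have exact_forms : halfSchouten (I := I) (M := M) Λ (dFun I f) (dFun I g) (dFun I h) x
      = wedge (I := I) (M := M) ξ Λ (dFun I f) (dFun I g) (dFun I h) x := by
    have jacobi := congrFun (hΛ.bracket_self f g h) x
    rw [schouten_self_eq_two_mul_halfSchouten hΛ.isBivector hΛx f.contMDiff g.contMDiff
      h.contMDiff] at jacobi
    exact mul_left_cancel₀ two_ne_zero jacobi
  rw [halfSchouten_congr hΛ.isBivector hΛx hα hβ hγ (Form.MDiffAt.dFun f.contMDiff x)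
    (Form.MDiffAt.dFun g.contMDiff x) (Form.MDiffAt.dFun h.contMDiff x) hf.symm hg.symm hh.symm,
    exact_forms]
  simp only [wedge, pair, hf, hg, hh]

end Schouten

section Anchor

variable {E : Type*} [NormedAddCommGroup E] [NormedSpace ℝ E]
  {H : Type*} [TopologicalSpace H] {I : ModelWithCorners ℝ E H}
  {M : Type*} [TopologicalSpace M] [ChartedSpace H M] {Λ : SharpField I M} {X : VField I M}

theorem dFun_const (c : ℝ) : dFun I (fun _ : M => c) = 0 := by
  ext1 x
  exact mvfderiv_const c

theorem dForm_zero (x : M) (v : TangentSpace I x) : dForm (0 : Form I M) x v = 0 := by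
  have chart : formInChart (0 : Form I M) x = fun _ => 0 := by
    ext1 z
    exact ContinuousLinearMap.zero_comp _
  simp only [dForm, chart, fderivWithin_fun_const, Pi.zero_apply, ContinuousLinearMap.flip_zero,
    zero_apply, sub_self]
  exact ContinuousLinearMap.zero_comp _

theorem dForm_zero_right (α : Form I M) (x : M) : dForm α x 0 = 0 := by
  have vanish (D : E →L[ℝ] E →L[ℝ] ℝ) (φ : E →L[ℝ] E) : (D (φ 0) - D.flip (φ 0)).comp φ = 0 := by
    simp only [map_zero, sub_self, ContinuousLinearMap.zero_comp]
  exact vanish _ _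

theorem lieForm_zero_left (α : Form I M) : lieForm 0 α = 0 := by
  have contraction : (fun y => α y ((0 : VField I M) y)) = fun _ => 0 :=
    funext fun y => (α y).map_zero
  ext1 x
  rw [lieForm, contraction, dFun_const, Pi.zero_apply, Pi.zero_apply, dForm_zero_right, add_zero]

theorem lieForm_zero_right (X : VField I M) : lieForm X (0 : Form I M) = 0 := by
  ext1 x
  rw [lieForm, dForm_zero, add_zero]
  exact congrFun (dFun_const 0) x

theorem anchor_form (Λ : SharpField I M) (X : VField I M) (α : Form I M) :
    anchor Λ X (α, 0) = sharp Λ α := by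
  ext1 x
  simp only [anchor, sharp, Pi.zero_apply, zero_smul, add_zero]

theorem anchor_function (Λ : SharpField I M) (X : VField I M) (f : M → ℝ) :
    anchor Λ X (0, f) = f • X := by
  ext1 x
  simp only [anchor, Pi.zero_apply, map_zero, zero_add, Pi.smul_apply']

/-- The failure `[#s, #t] - #{s, t}` of the anchor `#` of `(Λ, X)` to be a morphism of brackets. -/
def anchorDefect (Λ : SharpField I M) (X : VField I M) (s t : Form I M × (M → ℝ)) : VField I M :=
  VectorField.mlieBracket I (anchor Λ X s) (anchor Λ X t) - anchor Λ X (pairBracket Λ X s t)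

theorem anchorDefect_eq_zero_iff {s t : Form I M × (M → ℝ)} :
    anchorDefect Λ X s t = 0 ↔
      VectorField.mlieBracket I (anchor Λ X s) (anchor Λ X t)
        = anchor Λ X (pairBracket Λ X s t) :=
  sub_eq_zero

theorem anchorDefect_form_form (Λ : SharpField I M) (X : VField I M) (α β : Form I M) (x : M) :
    anchorDefect Λ X (α, 0) (β, 0) x =
      VectorField.mlieBracket I (sharp Λ α) (sharp Λ β) x
        - Λ x (formBracket Λ α β x - contractWedge X α β x) + pair Λ α β x • X x := by
  have dFun_zero : dFun I (0 : M → ℝ) = 0 := dFun_const 0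
  have pair_zero (γ : Form I M) : pair Λ γ 0 x = 0 := rfl
  simp only [anchorDefect, anchor_form, anchor, pairBracket, formBracket, dFun_zero, pair_zero,
    Pi.zero_apply, Pi.sub_apply, zero_smul, zero_mul, add_zero, sub_zero]
  module

theorem mlieBracket_anchor_form_function [CompleteSpace E] [IsManifold I 2 M] {α : Form I M}
    {f g : M → ℝ} {x : M} (hα : (sharp Λ α).MDiffAt x) (hX : X.MDiffAt x)
    (hf : MDifferentiableAt I 𝓘(ℝ, ℝ) f x) (hg : MDifferentiableAt I 𝓘(ℝ, ℝ) g x) :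
    VectorField.mlieBracket I (anchor Λ X (α, f)) (anchor Λ X (0, g)) x =
      (derivAlong (sharp Λ α) g x + f x * derivAlong X g x - g x * derivAlong X f x) • X x
        - g x • VectorField.mlieBracket I X (sharp Λ α) x := by
  have decomposition : anchor Λ X (α, f) = sharp Λ α + f • X := rfl
  have hfX : VField.MDiffAt (f • X) x := MDifferentiableAt.smul_section hf hX
  have d_apply_add : mvfderiv I g x (sharp Λ α x + f x • X x) =
      derivAlong (sharp Λ α) g x + f x * derivAlong X g x := by
    rw [map_add, map_smul]
    rfl
  have d_apply : mvfderiv I f x (X x) = derivAlong X f x := rfl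
  rw [anchor_function, decomposition, VectorField.mlieBracket_smul_right hg hX,
    VectorField.mlieBracket_add_left hα hfX, VectorField.mlieBracket_smul_left hf hX,
    VectorField.mlieBracket_swap_apply (V := sharp Λ α), VectorField.mlieBracket_self,
    Pi.add_apply, Pi.smul_apply', d_apply_add, d_apply, Pi.zero_apply]
  module

theorem anchor_pairBracket_form_function (Λ : SharpField I M) (X : VField I M) (α : Form I M)
    (f g : M → ℝ) (x : M) :
    anchor Λ X (pairBracket Λ X (α, f) (0, g)) x =
      (derivAlong (sharp Λ α) g x + f x * derivAlong X g x - g x * derivAlong X f x) • X x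
        - g x • Λ x (lieForm X α x) := by
  have sharp_zero : sharp Λ (0 : Form I M) = 0 := funext fun y => (Λ y).map_zero
  have pair_zero_right : pair Λ α 0 = fun _ => 0 := rfl
  have pair_zero_left (β : Form I M) : pair Λ 0 β x = 0 := by
    simp only [pair, Pi.zero_apply, map_zero]
  have pair_dFun : pair Λ α (dFun I g) x = derivAlong (sharp Λ α) g x := rfl
  simp only [anchor, pairBracket, sharp_zero, pair_zero_right, pair_zero_left, pair_dFun,
    contractWedge, lieForm_zero_left, lieForm_zero_right, dFun_const, Pi.zero_apply, zero_apply,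
    smul_zero, zero_smul, sub_zero, add_zero, zero_sub, neg_zero, zero_add, map_neg, map_smul]
  module

theorem anchorDefect_form_function [CompleteSpace E] [IsManifold I 2 M] {α : Form I M}
    {f g : M → ℝ} {x : M} (hα : (sharp Λ α).MDiffAt x) (hX : X.MDiffAt x)
    (hf : MDifferentiableAt I 𝓘(ℝ, ℝ) f x) (hg : MDifferentiableAt I 𝓘(ℝ, ℝ) g x) :
    anchorDefect Λ X (α, f) (0, g) x = -g x • bracketOne X Λ α x := by
  rw [anchorDefect, Pi.sub_apply, mlieBracket_anchor_form_function hα hX hf hg,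
    anchor_pairBracket_form_function, bracketOne]
  module

theorem apply_anchorDefect_form_form [CompleteSpace E] [IsManifold I 2 M] {α β γ : Form I M}
    {x : M} (hΛ : IsBivector Λ) (hΛx : Λ.MDiffAt x) (hα : α.MDiffAt x) (hβ : β.MDiffAt x)
    (hγ : γ.MDiffAt x) :
    γ x (anchorDefect Λ X (α, 0) (β, 0) x) = wedge X Λ α β γ x - halfSchouten Λ α β γ x := by
  rw [anchorDefect_form_form, halfSchouten_eq_formBracket hΛ hΛx hα hβ hγ]
  simp only [contractWedge, wedge, pair, map_add, map_sub, map_smul, smul_eq_mul,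
    hΛ.apply_swap (α x) (γ x)]
  ring

theorem IsJacobi.anchorDefect_form_form_eq_zero [FiniteDimensional ℝ E] [T2Space M]
    [IsManifold I ∞ M] {Λ : SmoothSharpField I M} {ξ : SmoothVField I M} (hΛ : IsJacobi Λ ξ)
    {α β : Form I M} {x : M} (hα : α.MDiffAt x) (hβ : β.MDiffAt x) :
    anchorDefect (I := I) (M := M) Λ ξ (α, 0) (β, 0) x = 0 := by
  have : CompleteSpace E := FiniteDimensional.complete ℝ E
  refine eq_zero_of_forall_covector fun a => ?_
  obtain ⟨γ, rfl⟩ := exists_smoothForm_eq (I := I) x a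
  have hγ := SmoothForm.mdiffAt γ x
  rw [apply_anchorDefect_form_form hΛ.isBivector (SmoothSharpField.mdiffAt Λ x) hα hβ hγ,
    hΛ.halfSchouten_eq_wedge hα hβ hγ, sub_self]

end Anchor

section Recursion

variable {E : Type*} [NormedAddCommGroup E] [NormedSpace ℝ E]
  {H : Type*} [TopologicalSpace H] {I : ModelWithCorners ℝ E H}
  {M : Type*} [TopologicalSpace M] [ChartedSpace H M]
  {Λ : SharpField I M} {X : VField I M} {J : EndField I M}

theorem Commutes.sharp_transp (hJ : Commutes J Λ) (α : Form I M) :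
    sharp Λ (transp J α) = act J (sharp Λ α) := by
  ext1 x
  exact (hJ x (α x)).symm

theorem act_bracketOne_add {α : Form I M} (hX : bracketOne X Λ α = 0)
    (hN : nijenhuis J X (sharp Λ α) = 0) :
    act J (bracketOne (act J X) Λ α + bracketOne X (actSharp J Λ) α) =
      bracketOne (act J X) (actSharp J Λ) α := by
  have sharp_actSharp : sharp (actSharp J Λ) α = act J (sharp Λ α) := rfl
  have actSharp_apply (x : M) (a : TangentSpace I x →L[ℝ] ℝ) : actSharp J Λ x a = J x (Λ x a) := rfl
  ext1 x
  have bracket : VectorField.mlieBracket I X (sharp Λ α) x = Λ x (lieForm X α x) :=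
    sub_eq_zero.1 (congrFun hX x)
  have torsion := congrFun hN x
  simp only [nijenhuis, act, Pi.add_apply, Pi.sub_apply, Pi.zero_apply, bracket] at torsion
  simp only [act, bracketOne, Pi.add_apply, map_add, map_sub, sharp_actSharp, actSharp_apply]
  rw [← sub_eq_zero, ← neg_eq_zero, ← torsion]
  abel

theorem act_concomitant_eq_neg_anchorDefect (hJ : Commutes J Λ) {α β : Form I M} {x : M}
    (h₁ : anchorDefect Λ X (transp J α, 0) (β, 0) x = 0)
    (h₂ : anchorDefect Λ X (α, 0) (transp J β, 0) x = 0)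
    (h₃ : anchorDefect Λ X (α, 0) (β, 0) x = 0)
    (hN : nijenhuis J (sharp Λ α) (sharp Λ β) x = 0) :
    J x (Λ x (concomitant Λ J α β x) - pair Λ α β x • J x (X x)
        + pair Λ α (transp J β) x • X x) =
      -anchorDefect (actSharp J Λ) (act J X) (α, 0) (β, 0) x := by
  have sharp_actSharp (γ : Form I M) : sharp (actSharp J Λ) γ = act J (sharp Λ γ) := rfl
  have actSharp_apply (a : TangentSpace I x →L[ℝ] ℝ) : actSharp J Λ x a = J x (Λ x a) := rfl
  have act_apply (Y : VField I M) : act J Y x = J x (Y x) := rfl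
  have transp_apply (γ : Form I M) : transp J γ x (X x) = γ x (J x (X x)) := rfl
  have sharp_transp_apply (γ : Form I M) : Λ x (transp J γ x) = J x (Λ x (γ x)) :=
    (hJ x (γ x)).symm
  have pair_transp_right : pair Λ α (transp J β) x = pair (actSharp J Λ) α β x := rfl
  have pair_transp_left : pair Λ (transp J α) β x = pair (actSharp J Λ) α β x :=
    congrArg (β x) (hJ x (α x)).symm
  simp only [anchorDefect_form_form, hJ.sharp_transp, contractWedge, pair_transp_left,
    pair_transp_right, transp_apply, sharp_transp_apply, map_sub, map_smul] at h₁ h₂ h₃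
  simp only [nijenhuis, Pi.add_apply, Pi.sub_apply, act_apply] at hN
  rw [sub_eq_iff_eq_add.1 (eq_sub_of_add_eq h₁), sub_eq_iff_eq_add.1 (eq_sub_of_add_eq h₂),
    sub_eq_iff_eq_add.1 (eq_sub_of_add_eq h₃)] at hN
  simp only [map_sub, map_add, map_smul, map_zero] at hN
  simp only [anchorDefect_form_form, sharp_actSharp, actSharp_apply, act_apply, concomitant,
    contractWedge, pair_transp_right, sharp_transp_apply, map_sub, map_smul, map_add,
    Pi.add_apply, Pi.sub_apply]
  rw [← sub_eq_zero, ← hN]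
  module

end Recursion

section Proposition

variable {E : Type*} [NormedAddCommGroup E] [NormedSpace ℝ E]
  {H : Type*} [TopologicalSpace H] {I : ModelWithCorners ℝ E H}
  {M : Type*} [TopologicalSpace M] [ChartedSpace H M] [IsManifold I ∞ M]
  {Λ : SmoothSharpField I M} {ξ : SmoothVField I M} {J : SmoothEndField I M}

theorem conditionA_iff_anchorDefect [CompleteSpace E]
    (hξ : ∀ α : SmoothForm I M, bracketOne (I := I) (M := M) ξ Λ α = 0)
    (hN : ∀ α : SmoothForm I M, nijenhuis (I := I) (M := M) J ξ (sharp Λ α) = 0) :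
    ConditionA Λ ξ J ↔ ∀ (α : SmoothForm I M) (f g : C^∞⟮I, M; ℝ⟯),
      anchorDefect (actSharp (I := I) (M := M) J Λ) (act (I := I) (M := M) J ξ)
        (α, f) (0, g) = 0 := by
  have defect (α : SmoothForm I M) (f g : C^∞⟮I, M; ℝ⟯) (x : M) :=
    anchorDefect_form_function (Λ := actSharp (I := I) (M := M) J Λ)
      (((SmoothForm.mdiffAt α x).sharp (SmoothSharpField.mdiffAt Λ x)).act
        (SmoothEndField.mdiffAt J x))
      ((SmoothVField.mdiffAt ξ x).act (SmoothEndField.mdiffAt J x))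
      ((f.contMDiff x).mdifferentiableAt (by simp)) ((g.contMDiff x).mdifferentiableAt (by simp))
  refine forall_congr' fun α => ?_
  rw [act_bracketOne_add (hξ α) (hN α)]
  refine ⟨fun bracket f g => funext fun x => ?_, fun vanish => funext fun x => ?_⟩
  · rw [defect, bracket, Pi.zero_apply, smul_zero]
  · have unit_coefficient := (defect α 0 1 x).symm.trans (congrFun (vanish 0 1) x)
    exact (smul_eq_zero.1 unit_coefficient).resolve_left (neg_ne_zero.2 one_ne_zero)

theorem conditionB_iff_anchorDefect [FiniteDimensional ℝ E] [T2Space M] (hΛ : IsJacobi Λ ξ)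
    (hJ : Commutes (I := I) (M := M) J Λ)
    (hN : ∀ α β : SmoothForm I M,
      nijenhuis (I := I) (M := M) J (sharp Λ α) (sharp Λ β) = 0) :
    ConditionB Λ ξ J ↔ ∀ α β : SmoothForm I M,
      anchorDefect (actSharp (I := I) (M := M) J Λ) (act (I := I) (M := M) J ξ)
        (α, 0) (β, 0) = 0 := by
  refine forall_congr' fun α => forall_congr' fun β => ?_
  have defect (x : M) := act_concomitant_eq_neg_anchorDefect hJ
    (hΛ.anchorDefect_form_form_eq_zero
      ((SmoothForm.mdiffAt α x).transp (SmoothEndField.mdiffAt J x)) (SmoothForm.mdiffAt β x))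
    (hΛ.anchorDefect_form_form_eq_zero
      (SmoothForm.mdiffAt α x) ((SmoothForm.mdiffAt β x).transp (SmoothEndField.mdiffAt J x)))
    (hΛ.anchorDefect_form_form_eq_zero (SmoothForm.mdiffAt α x) (SmoothForm.mdiffAt β x))
    (congrFun (hN α β) x)
  refine ⟨fun condition => funext fun x => ?_, fun vanish γ x => ?_⟩
  · rw [Pi.zero_apply, ← neg_eq_zero, ← defect x]
    refine eq_zero_of_forall_covector fun a => ?_
    obtain ⟨γ, rfl⟩ := exists_smoothForm_eq (I := I) x a
    exact condition γ x
  · have image_zero := defect x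
    rw [vanish, Pi.zero_apply, neg_zero] at image_zero
    exact (congrArg (γ x) image_zero).trans (γ x).map_zero

end Proposition

end JacobiNijenhuis

end

open JacobiNijenhuis in
theorem mainTheorem8_general
    {E : Type*} [NormedAddCommGroup E] [NormedSpace ℝ E] [FiniteDimensional ℝ E]
    {H : Type*} [TopologicalSpace H] {I : ModelWithCorners ℝ E H}
    {M : Type*} [TopologicalSpace M] [T2Space M] [ChartedSpace H M] [IsManifold I ∞ M]
    {Λ : SmoothSharpField I M} {ξ : SmoothVField I M} (hΛ : IsJacobi Λ ξ)
    {J : SmoothEndField I M} (hJ : Commutes (I := I) (M := M) J Λ)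
    (hN : ∀ (α β : SmoothForm I M) (f g : C^∞⟮I, M; ℝ⟯),
      nijenhuis (I := I) (M := M) J
        (anchor (I := I) (M := M) Λ ξ (α, f)) (anchor (I := I) (M := M) Λ ξ (β, g)) = 0) :
    let JΛ : SharpField I M := actSharp (I := I) (M := M) J Λ
    let Jξ : VField I M := act (I := I) (M := M) J ξ
    (ConditionA Λ ξ J ↔ ∀ (α : SmoothForm I M) (f g : C^∞⟮I, M; ℝ⟯),
      VectorField.mlieBracket I (anchor JΛ Jξ (α, f)) (anchor JΛ Jξ (0, g))
        = anchor JΛ Jξ (pairBracket JΛ Jξ (α, f) (0, g)))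
    ∧ (ConditionB Λ ξ J ↔ ∀ α β : SmoothForm I M,
      VectorField.mlieBracket I (anchor JΛ Jξ (α, 0)) (anchor JΛ Jξ (β, 0))
        = anchor JΛ Jξ (pairBracket JΛ Jξ (α, 0) (β, 0))) := by
  have : CompleteSpace E := FiniteDimensional.complete ℝ E
  have torsion_field (α : SmoothForm I M) : nijenhuis (I := I) (M := M) J ξ (sharp Λ α) = 0 := by
    simpa only [ContMDiffSection.coe_zero, ContMDiffMap.coe_zero, ContMDiffMap.coe_one,
      anchor_function, anchor_form, one_smul] using hN 0 α 1 0
  have torsion_forms (α β : SmoothForm I M) :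
      nijenhuis (I := I) (M := M) J (sharp Λ α) (sharp Λ β) = 0 := by
    simpa only [ContMDiffMap.coe_zero, anchor_form] using hN α β 0 0
  simp only [← anchorDefect_eq_zero_iff]
  exact ⟨conditionA_iff_anchorDefect hΛ.bracket_left torsion_field,
    conditionB_iff_anchorDefect hΛ hJ torsion_forms⟩

theorem mainTheorem8
    {E : Type*} [NormedAddCommGroup E] [NormedSpace ℝ E] [FiniteDimensional ℝ E]
    {H : Type*} [TopologicalSpace H] (I : ModelWithCorners ℝ E H) [I.Boundaryless]
    (M : Type*) [TopologicalSpace M] [T2Space M] [ChartedSpace H M] [IsManifold I ∞ M]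
    (Λ : JacobiNijenhuis.SmoothSharpField I M) (ξ : JacobiNijenhuis.SmoothVField I M)
    (hΛ : JacobiNijenhuis.IsJacobi Λ ξ)
    (J : JacobiNijenhuis.SmoothEndField I M)
    (hJ : JacobiNijenhuis.Commutes (I := I) (M := M) J Λ)
    (hN : ∀ (α β : JacobiNijenhuis.SmoothForm I M) (f g : C^∞⟮I, M; ℝ⟯),
      JacobiNijenhuis.nijenhuis (I := I) (M := M) J
        (JacobiNijenhuis.anchor (I := I) (M := M) Λ ξ (α, f))
        (JacobiNijenhuis.anchor (I := I) (M := M) Λ ξ (β, g)) = 0)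
    (JΛ : JacobiNijenhuis.SharpField I M)
    (hJΛ : JΛ = JacobiNijenhuis.actSharp (I := I) (M := M) J Λ)
    (Jξ : JacobiNijenhuis.VField I M)
    (hJξ : Jξ = JacobiNijenhuis.act (I := I) (M := M) J ξ) :
    (JacobiNijenhuis.ConditionA Λ ξ J ↔
      ∀ (α : JacobiNijenhuis.SmoothForm I M) (f g : C^∞⟮I, M; ℝ⟯),
        VectorField.mlieBracket I
            (JacobiNijenhuis.anchor JΛ Jξ (α, f)) (JacobiNijenhuis.anchor JΛ Jξ (0, g))
          = JacobiNijenhuis.anchor JΛ Jξ (JacobiNijenhuis.pairBracket JΛ Jξ (α, f) (0, g)))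
    ∧ (JacobiNijenhuis.ConditionB Λ ξ J ↔
      ∀ α β : JacobiNijenhuis.SmoothForm I M,
        VectorField.mlieBracket I
            (JacobiNijenhuis.anchor JΛ Jξ (α, 0)) (JacobiNijenhuis.anchor JΛ Jξ (β, 0))
          = JacobiNijenhuis.anchor JΛ Jξ
              (JacobiNijenhuis.pairBracket JΛ Jξ (α, 0) (β, 0))) := by
  subst hJΛ hJξ
  exact mainTheorem8_general hΛ hJ hN
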